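/- Let $K\ge 3$ and $N\ge 2$ be integers and let $\theta,p>0$ be real. Consider $N$ particles on the cycle $\mathbb{Z}/K\mathbb{Z}$, i.e. the continuous-time Markov chain on the finite set $$\mathcal{E}_{K,N}=\Big\{\eta:\mathbb{Z}/K\mathbb{Z}\to\mathbb{N},\ \sum_{k}\eta(k)=N\Big\}$$ with generator $$\mathcal{L}f(\eta)=\sum_{i,j\in\mathbb{Z}/K\mathbb{Z}}\eta(i)\,\big[f(\eta-e_i+e_j)-f(\eta)\big]\Big(\mathbf{1}_{\{j=i+1\}}+\theta\,\mathbf{1}_{\{j=i-1\}}+p\,\frac{\eta(j)}{N-1}\Big),$$ where $e_i$ is the $i$-th canonical vector and terms with $\eta(i)=0$ are zero. Let $\nu_N$ be its stationary distribution, i.e. a probability measure on $\mathcal{E}_{K,N}$ invariant under the semigroup $(e^{t\mathcal{L}})_{t\ge 0}$. Let $T_n$ and $U_n$ be the Chebyshev polynomials of the first and second kind, with $U_{-1}=0$, and put $$\beta_N=2\Big(1+\frac{p}{(N-1)(1+\theta)}\Big).$$ (a) If $K=2K_2$ with $K_2\ge 2$, then $$\operatorname{Var}_{\nu_N}\Big[\frac{\eta(0)}{N}\Big]=\frac{N-1}{KN}\,\frac{2}{\beta_N+2}\,\frac{T_{K_2}(\beta_N/2)}{U_{K_2-1}(\beta_N/2)}+\frac{1}{KN}-\frac{1}{K^2},$$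 and, for all $1\le k\le K_2-1$, $$\operatorname{Cov}_{\nu_N}\Big[\frac{\eta(0)}{N},\frac{\eta(k)}{N}\Big]=\frac{N-1}{KN}\,\frac{2}{\beta_N+2}\,\frac{T_{K_2-k}(\beta_N/2)}{U_{K_2-1}(\beta_N/2)}-\frac{1}{K^2}.$$ (b) If $K=2K_2+1$ with $K_2\ge 1$, then $$\operatorname{Var}_{\nu_N}\Big[\frac{\eta(0)}{N}\Big]=\frac{N-1}{KN}\,\frac{U_{K_2}(\beta_N/2)-U_{K_2-1}(\beta_N/2)}{U_{K_2}(\beta_N/2)+U_{K_2-1}(\beta_N/2)}+\frac{1}{KN}-\frac{1}{K^2},$$ and, for all $1\le k\le K_2$, $$\operatorname{Cov}_{\nu_N}\Big[\frac{\eta(0)}{N},\frac{\eta(k)}{N}\Big]=\frac{N-1}{KN}\,\frac{U_{K_2-k}(\beta_N/2)-U_{K_2-k-1}(\beta_N/2)}{U_{K_2}(\beta_N/2)+U_{K_2-1}(\beta_N/2)}-\frac{1}{K^2}.$$ -/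

import Mathlib

open ProbabilityTheory MeasureTheory Polynomial

noncomputable section

/-- Configurations of `N` particles on the cycle `ℤ/Kℤ`: `η k` is the number of particles
at the site `k`, and the numbers add up to `N`. -/
def Config (K N : ℕ) [NeZero K] : Type :=
  {η : ZMod K → ℕ // ∑ k, η k = N}

namespace Config

variable {K N : ℕ} [NeZero K]

instance : CoeFun (Config K N) (fun _ => ZMod K → ℕ) := ⟨Subtype.val⟩

instance : Fintype (Config K N) :=
  Fintype.subtype (Finset.piAntidiag (Finset.univ : Finset (ZMod K)) N) (by simp)

/-- The finite state space carries the discrete sigma-algebra. -/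
instance : MeasurableSpace (Config K N) := ⊤

instance : DiscreteMeasurableSpace (Config K N) := ⟨fun _ => trivial⟩

theorem sum_move (η : Config K N) (i j : ZMod K) (h : 0 < η i) :
    ∑ k, (η k - (Pi.single i 1 : ZMod K → ℕ) k + (Pi.single j 1 : ZMod K → ℕ) k) = N := by
  have h1 : ∀ k, (Pi.single i 1 : ZMod K → ℕ) k ≤ η k := by
    intro k
    by_cases hk : k = i
    · subst hk
      simpa using Nat.succ_le_of_lt h
    · simp [hk]
  have h2 : ∑ k, (Pi.single i 1 : ZMod K → ℕ) k ≤ ∑ k, η k :=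
    Finset.sum_le_sum fun k _ => h1 k
  rw [Finset.sum_add_distrib, Finset.sum_tsub_distrib _ fun k _ => h1 k]
  have h3 := η.2
  simp only [Finset.sum_pi_single', Finset.mem_univ, if_true] at h2 ⊢
  omega

/-- `η.move i j = η - e_i + e_j`: one particle jumps from `i` to `j`. If the site `i` is empty,
the value is irrelevant (it only occurs with the factor `η i = 0`) and is set to `η`. -/
def move (η : Config K N) (i j : ZMod K) : Config K N :=
  if h : 0 < η i then
    ⟨fun k => η k - (Pi.single i 1 : ZMod K → ℕ) k + (Pi.single j 1 : ZMod K → ℕ) k,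
      sum_move η i j h⟩
  else η

/-- The rate at which each particle located at `i` jumps to `j` in the configuration `η`. -/
def jumpRate (θ p : ℝ) (η : Config K N) (i j : ZMod K) : ℝ :=
  (if j = i + 1 then 1 else 0) + θ * (if j = i - 1 then 1 else 0) + p * (η j / ((N : ℝ) - 1))

/-- The generator of the `N`-particle process, as a linear operator on the functions on the
state space. -/
def generator (K N : ℕ) [NeZero K] (θ p : ℝ) : (Config K N → ℝ) →ₗ[ℝ] (Config K N → ℝ) where
  toFun f := fun η => ∑ i, ∑ j, (η i : ℝ) * (f (η.move i j) - f η) * jumpRate θ p η i j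
  map_add' f g := by
    funext η
    simp only [Pi.add_apply, ← Finset.sum_add_distrib]
    exact Finset.sum_congr rfl fun i _ => Finset.sum_congr rfl fun j _ => by ring
  map_smul' c f := by
    funext η
    simp only [Pi.smul_apply, smul_eq_mul, RingHom.id_apply, Finset.mul_sum]
    exact Finset.sum_congr rfl fun i _ => Finset.sum_congr rfl fun j _ => by ring

/-- The transition semigroup `P_t = exp(t L)` of the `N`-particle process:
`(P_t f)(η)` is the expectation of `f` at time `t` for the process started in `η`. -/
def semigroup (K N : ℕ) [NeZero K] (θ p t : ℝ) : (Config K N → ℝ) →L[ℝ] (Config K N → ℝ) :=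
  NormedSpace.exp (t • LinearMap.toContinuousLinearMap (generator K N θ p))

/-- `ν` is stationary for the `N`-particle process: `ν P_t = ν` for every time `t ≥ 0`. -/
def IsStationary (θ p : ℝ) (ν : Measure (Config K N)) : Prop :=
  ∀ t : ℝ, 0 ≤ t → ∀ f : Config K N → ℝ, ∫ η, semigroup K N θ p t f η ∂ν = ∫ η, f η ∂ν

/-- The proportion `η(k)/N` of particles at the site `k`. -/
def proportion (k : ZMod K) (η : Config K N) : ℝ := (η k : ℝ) / N

end Config

/-- `β_N = 2 (1 + p / ((N - 1) (1 + θ)))`. -/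
def betaN (N : ℕ) (θ p : ℝ) : ℝ := 2 * (1 + p / (((N : ℝ) - 1) * (1 + θ)))

/-- The value at `x` of the Chebyshev polynomial of the first kind `T_n`. -/
def chebT (n : ℤ) (x : ℝ) : ℝ := (Polynomial.Chebyshev.T ℝ n).eval x

/-- The value at `x` of the Chebyshev polynomial of the second kind `U_n` (`U_{-1} = 0`). -/
def chebU (n : ℤ) (x : ℝ) : ℝ := (Polynomial.Chebyshev.U ℝ n).eval x

end

/-! Stationarity gives `∫ L f dν = 0` for every `f`, and `L` closes on first and second moments.
Means are harmonic for a nearest-neighbour walk on the cycle, hence equal to `N / K`. Counts of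
pairs of distinct particles evolve as two independent walkers killed at rate `2p / (N - 1)`, with a
source on the diagonal (`generator_pairCount`). The maximum principle makes the solution of that
linear system unique, so translation invariance of `ν` need not be shown: it suffices to exhibit a
solution depending on `l - k` alone. The difference of the walkers is symmetric, so `θ` enters only
through `betaN` and the equation is the Chebyshev recurrence, with a source at `0` and symmetry
about `K / 2` (`integral_pairCount`). Parity of `K` decides which Chebyshev functions have that
symmetry. -/

namespace Config

variable {K N : ℕ} [NeZero K]

/-! ### The generator on first and second moments -/

theorem sum_cast (η : Config K N) : ∑ k, (η k : ℝ) = N := by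
  exact_mod_cast congrArg (Nat.cast (R := ℝ)) η.2

theorem move_apply (η : Config K N) (i j k : ZMod K) (h : 0 < η i) :
    (η.move i j k : ℝ) = η k - (if k = i then 1 else 0) + (if k = j then 1 else 0) := by
  have h1 : (Pi.single i 1 : ZMod K → ℕ) k ≤ η k := by
    by_cases hk : k = i
    · subst hk
      simpa using Nat.succ_le_of_lt h
    · simp [hk]
  have h2 : η.move i j k
      = η k - (Pi.single i 1 : ZMod K → ℕ) k + (Pi.single j 1 : ZMod K → ℕ) k :=
    congrArg (fun ξ : Config K N => ξ k) (dif_pos h : η.move i j = _)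
  rw [h2, Nat.cast_add, Nat.cast_sub h1]
  simp [Pi.single_apply]

/-- The rate at which particles enter `k`. -/
theorem sum_mul_jumpRate (θ p : ℝ) (η : Config K N) (k : ZMod K) :
    ∑ i, (η i : ℝ) * jumpRate θ p η i k
      = η (k - 1) + θ * η (k + 1) + p / ((N : ℝ) - 1) * N * η k := by
  have h1 : ∀ i : ZMod K, (k = i + 1) ↔ (i = k - 1) := fun i => by
    rw [eq_sub_iff_add_eq, eq_comm]
  have h2 : ∀ i : ZMod K, (k = i - 1) ↔ (i = k + 1) := fun i => by
    rw [eq_sub_iff_add_eq, eq_comm]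
  simp only [jumpRate, mul_add, Finset.sum_add_distrib, h1, h2, mul_ite, mul_one, mul_zero,
    Finset.sum_ite_eq', Finset.mem_univ, if_true, ← Finset.sum_mul, sum_cast]
  ring

/-- The total rate at which a particle leaves `k`. -/
theorem sum_jumpRate (θ p : ℝ) (η : Config K N) (k : ZMod K) :
    ∑ j, jumpRate θ p η k j = 1 + θ + p / ((N : ℝ) - 1) * N := by
  simp only [jumpRate, Finset.sum_add_distrib, mul_ite, mul_one, mul_zero,
    Finset.sum_ite_eq', Finset.mem_univ, if_true, ← Finset.mul_sum, ← Finset.sum_div, sum_cast]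
  simp
  ring

theorem generator_eq_of_increment (θ p : ℝ) (η : Config K N) (f : Config K N → ℝ)
    (D : ZMod K → ZMod K → ℝ) (hD : ∀ i j, 0 < η i → f (η.move i j) - f η = D i j) :
    generator K N θ p f η = ∑ i, ∑ j, (η i * jumpRate θ p η i j) * D i j := by
  refine Finset.sum_congr rfl fun i _ => Finset.sum_congr rfl fun j _ => ?_
  rcases Nat.eq_zero_or_pos (η i) with h | h
  · simp [h]
  · rw [hD i j h]
    ring

theorem sum_flux_in (θ p : ℝ) (η : Config K N) (k : ZMod K) :
    ∑ i, ∑ j, (η i * jumpRate θ p η i j) * (if k = j then 1 else 0)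
      = η (k - 1) + θ * η (k + 1) + p / ((N : ℝ) - 1) * N * η k := by
  rw [← sum_mul_jumpRate]
  simp

theorem sum_flux_out (θ p : ℝ) (η : Config K N) (k : ZMod K) :
    ∑ i, ∑ j, (η i * jumpRate θ p η i j) * (if k = i then 1 else 0)
      = η k * (1 + θ + p / ((N : ℝ) - 1) * N) := by
  rw [← sum_jumpRate θ p η k, Finset.mul_sum, Finset.sum_comm]
  simp

theorem sum_flux_pair (θ p : ℝ) (η : Config K N) (k l : ZMod K) :
    ∑ i, ∑ j, (η i * jumpRate θ p η i j) * ((if k = i then 1 else 0) * (if l = j then 1 else 0))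
      = η k * jumpRate θ p η k l := by
  simp

/-- The mean-field jumps into and out of `k` balance exactly, so `p` drops out. -/
theorem generator_count (θ p : ℝ) (η : Config K N) (k : ZMod K) :
    generator K N θ p (fun η => (η k : ℝ)) η
      = η (k - 1) + θ * η (k + 1) - (1 + θ) * η k := by
  rw [generator_eq_of_increment θ p η _
    (fun i j => (if k = j then 1 else 0) - (if k = i then 1 else 0))
    (fun i j h => by rw [move_apply η i j k h]; ring)]
  simp only [mul_sub, Finset.sum_sub_distrib, sum_flux_in, sum_flux_out]
  ring

/-- The number of ordered pairs of distinct particles, the first at `k` and the second at `l`. -/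
def pairCount (k l : ZMod K) (η : Config K N) : ℝ :=
  η k * η l - (if k = l then (η k : ℝ) else 0)

/-- Jumps onto a third particle cancel over ordered triples. Jumps onto the partner destroy the pair
at rate `2p / (N - 1)` and create a pair on the diagonal, whence the source `2 p η k`. -/
theorem generator_pairCount (hN : 2 ≤ N) (θ p : ℝ) (η : Config K N) (k l : ZMod K) :
    generator K N θ p (pairCount k l) η
      = pairCount (k - 1) l η + θ * pairCount (k + 1) l η
        + pairCount k (l - 1) η + θ * pairCount k (l + 1) η
        - (2 * (1 + θ) + 2 * (p / ((N : ℝ) - 1))) * pairCount k l η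
        + (if k = l then 2 * p * (η k : ℝ) else 0) := by
  -- Product rule for `η k * η l`. When `k = l`, the squared increment adds the indicators of `k =
  -- i` and `k = j`; subtracting the increment of `η k` leaves twice the first.
  rw [generator_eq_of_increment θ p η _
    (fun i j => η k * ((if l = j then 1 else 0) - (if l = i then 1 else 0))
      + η l * ((if k = j then 1 else 0) - (if k = i then 1 else 0))
      + 2 * (if k = l then 1 else 0) * (if k = i then 1 else 0)
      - (if l = i then 1 else 0) * (if k = j then 1 else 0)
      - (if k = i then 1 else 0) * (if l = j then 1 else 0))
    (fun i j h => by
      simp only [pairCount]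
      rw [move_apply η i j k h, move_apply η i j l h]
      by_cases hkl : k = l
      · subst hkl
        simp only [if_true]
        split_ifs <;> ring
      · simp only [hkl, if_false]
        have h1 : (if k = i then (1 : ℝ) else 0) * (if l = i then 1 else 0) = 0 := by
          split_ifs with a b <;> simp
          exact hkl (a.trans b.symm)
        have h2 : (if k = j then (1 : ℝ) else 0) * (if l = j then 1 else 0) = 0 := by
          split_ifs with a b <;> simp
          exact hkl (a.trans b.symm)
        linear_combination h1 + h2)]
  have e : ∀ i j : ZMod K, (η i * jumpRate θ p η i j) *
      (η k * ((if l = j then 1 else 0) - (if l = i then 1 else 0))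
      + η l * ((if k = j then 1 else 0) - (if k = i then 1 else 0))
      + 2 * (if k = l then 1 else 0) * (if k = i then 1 else 0)
      - (if l = i then 1 else 0) * (if k = j then 1 else 0)
      - (if k = i then 1 else 0) * (if l = j then 1 else 0))
    = η k * ((η i * jumpRate θ p η i j) * (if l = j then 1 else 0))
      - η k * ((η i * jumpRate θ p η i j) * (if l = i then 1 else 0))
      + η l * ((η i * jumpRate θ p η i j) * (if k = j then 1 else 0))
      - η l * ((η i * jumpRate θ p η i j) * (if k = i then 1 else 0))
      + 2 * (if k = l then 1 else 0) * ((η i * jumpRate θ p η i j) * (if k = i then 1 else 0))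
      - (η i * jumpRate θ p η i j) * ((if l = i then 1 else 0) * (if k = j then 1 else 0))
      - (η i * jumpRate θ p η i j) * ((if k = i then 1 else 0) * (if l = j then 1 else 0)) :=
    fun i j => by ring
  simp only [e, Finset.sum_add_distrib, Finset.sum_sub_distrib, ← Finset.mul_sum, sum_flux_in,
    sum_flux_out, sum_flux_pair]
  have hN1 : (N : ℝ) - 1 ≠ 0 := by
    have : (2 : ℝ) ≤ N := by exact_mod_cast hN
    linarith
  have hp : p = p / ((N : ℝ) - 1) * (N - 1) := by field_simp
  have e1 : (k = l - 1) ↔ (l = k + 1) := by rw [eq_sub_iff_add_eq, eq_comm]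
  have e2 : (k = l + 1) ↔ (l = k - 1) := by rw [eq_sub_iff_add_eq, eq_comm]
  have e3 : (k - 1 = l) ↔ (l = k - 1) := eq_comm
  have e4 : (k + 1 = l) ↔ (l = k + 1) := eq_comm
  have hr : ∀ a : ℝ, p * (a / ((N : ℝ) - 1)) = p / ((N : ℝ) - 1) * a := fun a => by ring
  simp only [pairCount, jumpRate, e1, e2, e3, e4, hr]
  have c1 : (if l = k + 1 then (η (k + 1) : ℝ) else 0) = if l = k + 1 then (η l : ℝ) else 0 := by
    split_ifs with h <;> simp [h]
  have c2 : (if l = k - 1 then (η (k - 1) : ℝ) else 0) = if l = k - 1 then (η l : ℝ) else 0 := by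
    split_ifs with h <;> simp [h]
  have i1 : ∀ (P : Prop) [Decidable P] (a : ℝ),
      (if P then a else 0) = a * (if P then 1 else 0) := fun P _ a => by
    split_ifs <;> simp
  have hkl : (if k = l then (1 : ℝ) else 0) * η l = (if k = l then (1 : ℝ) else 0) * η k := by
    split_ifs with h <;> simp [h]
  rw [c1, c2, i1 _ (η l : ℝ), i1 _ (η l : ℝ), i1 _ (η k : ℝ), i1 _ (2 * p * (η k : ℝ)),
    i1 _ (η k : ℝ), i1 _ (η k : ℝ)]
  generalize p / ((N : ℝ) - 1) = q at *
  subst hp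
  ring

theorem IsStationary.integral_generator {θ p : ℝ} {ν : Measure (Config K N)} [IsFiniteMeasure ν]
    (hν : IsStationary θ p ν) (f : Config K N → ℝ) :
    ∫ η, generator K N θ p f η ∂ν = 0 := by
  set A := LinearMap.toContinuousLinearMap (generator K N θ p) with hA
  have h1 : HasDerivAt (fun t : ℝ => NormedSpace.exp (t • A)) A 0 := by
    simpa using hasDerivAt_exp_smul_const (𝕂 := ℝ) A 0
  have h2 : HasDerivAt (fun t : ℝ => NormedSpace.exp (t • A) f) (A f) 0 := by
    simpa using h1.clm_apply (hasDerivAt_const (0 : ℝ) f)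
  have h3 : HasDerivAt (fun t : ℝ => ∑ η, ν.real {η} • semigroup K N θ p t f η)
      (∑ η, ν.real {η} • generator K N θ p f η) 0 :=
    HasDerivAt.fun_sum fun η _ => ((hasDerivAt_pi.1 h2) η).const_mul (ν.real {η})
  simp only [← integral_fintype Integrable.of_finite] at h3
  -- Invariance is known only for `t ≥ 0`, so derivatives are compared within `Set.Ici 0`.
  have h4 : HasDerivWithinAt (fun t : ℝ => ∫ η, semigroup K N θ p t f η ∂ν) 0 (Set.Ici 0) 0 :=
    (hasDerivWithinAt_const (0 : ℝ) (Set.Ici 0) (∫ η, f η ∂ν)).congr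
      (fun t ht => hν t ht f) (hν 0 le_rfl f)
  exact UniqueDiffWithinAt.eq_deriv _ (uniqueDiffOn_Ici (0 : ℝ) 0 Set.self_mem_Ici)
    h3.hasDerivWithinAt h4

end Config

/-! ### Maximum principles and recurrences on the cycle -/

/-- A function on the cycle that is harmonic for a nearest-neighbour walk is constant. -/
theorem ZMod.eq_of_harmonic {K : ℕ} [NeZero K] {θ : ℝ} (hθ : 0 < θ) (a : ZMod K → ℝ)
    (h : ∀ k, a (k - 1) + θ * a (k + 1) = (1 + θ) * a k) (k l : ZMod K) : a k = a l := by
  obtain ⟨m, hm⟩ := Finite.exists_max a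
  -- At a maximum the weighted average of the neighbours equals the maximum, so it propagates to the
  -- right because `θ > 0`.
  have step : ∀ n : ℕ, a (m + n) = a m := by
    intro n
    induction n with
    | zero => simp
    | succ n ih =>
      have h1 := h (m + n)
      have h2 := hm (m + n - 1)
      have h3 := hm (m + n + 1)
      have h4 : θ * a (m + n + 1) ≤ θ * a m := mul_le_mul_of_nonneg_left h3 hθ.le
      rw [ih] at h1
      push_cast
      rw [← add_assoc]
      exact mul_left_cancel₀ hθ.ne' (by linarith)
  have all : ∀ k, a k = a m := fun k => by
    have := step (k - m).val
    rwa [ZMod.natCast_zmod_val, add_sub_cancel] at this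
  rw [all k, all l]

/-- The maximum principle for a pair of independent walks killed at rate `c > 0`. -/
theorem ZMod.le_zero_of_killed_harmonic {K : ℕ} [NeZero K] {θ c : ℝ} (hθ : 0 < θ) (hc : 0 < c)
    (d : ZMod K → ZMod K → ℝ)
    (h : ∀ k l, d (k - 1) l + θ * d (k + 1) l + d k (l - 1) + θ * d k (l + 1)
      = (2 * (1 + θ) + c) * d k l) (k l : ZMod K) : d k l ≤ 0 := by
  obtain ⟨⟨m, n⟩, hm⟩ := Finite.exists_max fun x : ZMod K × ZMod K => d x.1 x.2
  have hm' : ∀ k l, d k l ≤ d m n := fun k l => hm (k, l)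
  refine (hm' k l).trans ?_
  have h0 := h m n
  have h1 := hm' (m - 1) n
  have h2 := mul_le_mul_of_nonneg_left (hm' (m + 1) n) hθ.le
  have h3 := hm' m (n - 1)
  have h4 := mul_le_mul_of_nonneg_left (hm' m (n + 1)) hθ.le
  exact nonpos_of_mul_nonpos_right (by linarith : c * d m n ≤ 0) hc

theorem ZMod.eq_zero_of_killed_harmonic {K : ℕ} [NeZero K] {θ c : ℝ} (hθ : 0 < θ) (hc : 0 < c)
    (d : ZMod K → ZMod K → ℝ)
    (h : ∀ k l, d (k - 1) l + θ * d (k + 1) l + d k (l - 1) + θ * d k (l + 1)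
      = (2 * (1 + θ) + c) * d k l) (k l : ZMod K) : d k l = 0 := by
  refine le_antisymm (ZMod.le_zero_of_killed_harmonic hθ hc d h k l) ?_
  have := ZMod.le_zero_of_killed_harmonic hθ hc (fun k l => -d k l)
    (fun k l => by linarith [h k l]) k l
  linarith

/-- A solution `G` on `ℤ` of a three-term recurrence, symmetric about `K / 2`, restricts to a
solution on the cycle with a source at `0`. -/
theorem ZMod.recurrence_val {K : ℕ} [NeZero K] (hK : 2 ≤ K) (G : ℤ → ℝ) (β : ℝ)
    (hG : ∀ n, G (n - 1) + G (n + 1) = β * G n) (hs : ∀ n, G (K - n) = G n) (m : ZMod K) :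
    β * G m.val - G (m - 1).val - G (m + 1).val
      = if m = 0 then β * G 0 - 2 * G 1 else 0 := by
  have : Fact (1 < K) := ⟨hK⟩
  have v1 : (1 : ZMod K).val = 1 := ZMod.val_one K
  have hp : ∀ m : ZMod K, G (m + 1).val = G (m.val + 1) := fun m => by
    rcases lt_or_ge (m.val + 1) K with h | h
    · rw [ZMod.val_add_of_lt (by rwa [v1]), v1]
      push_cast
      rfl
    -- The representative wraps from `K - 1` to `0`; symmetry gives `G K = G 0`.
    · have hv : m.val + 1 = K := le_antisymm (ZMod.val_lt m) h
      have : m + 1 = 0 := by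
        rw [← ZMod.natCast_zmod_val m, ← Nat.cast_succ, Nat.succ_eq_add_one, hv]
        simp
      rw [this, ZMod.val_zero]
      have h0 := hs 0
      have e : (m.val : ℤ) + 1 = K := by exact_mod_cast hv
      rw [e]
      simpa using h0.symm
  split_ifs with h
  · subst h
    -- The left neighbour of `0` carries `G (K - 1) = G 1` rather than `G (-1)`: this defect is the
    -- source.
    have hn : ((0 : ZMod K) - 1).val = K - 1 := by
      rw [zero_sub]
      have : NeZero (1 : ZMod K) := ⟨one_ne_zero⟩
      rw [ZMod.val_neg_of_ne_zero, v1]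
    rw [hp, hn, Nat.cast_sub (by omega), Nat.cast_one, hs]
    simp
    ring
  · have h1 : 1 ≤ m.val := Nat.one_le_iff_ne_zero.2 fun h0 => h ((ZMod.val_eq_zero m).1 h0)
    rw [hp, ZMod.val_sub (by rwa [v1]), v1, Nat.cast_sub h1, Nat.cast_one]
    linarith [hG m.val]


/-! ### Stationary moments and covariances -/

namespace Config

variable {K N : ℕ} [NeZero K]

theorem IsStationary.integral_count {θ p : ℝ} (hθ : 0 < θ) {ν : Measure (Config K N)}
    [IsProbabilityMeasure ν] (hν : IsStationary θ p ν) (k : ZMod K) :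
    ∫ η, (η k : ℝ) ∂ν = N / K := by
  have int : ∀ f : Config K N → ℝ, Integrable f ν := fun f => Integrable.of_finite
  have hc : ∀ k l : ZMod K, ∫ η, (η k : ℝ) ∂ν = ∫ η, (η l : ℝ) ∂ν := by
    refine ZMod.eq_of_harmonic hθ (fun k : ZMod K => ∫ η, (η k : ℝ) ∂ν) fun k => ?_
    have h := hν.integral_generator fun η => (η k : ℝ)
    simp only [generator_count] at h
    rw [integral_sub (int _) (int _), integral_add (int _) (int _), integral_const_mul,
      integral_const_mul] at h
    linarith
  have hs : ∑ l : ZMod K, ∫ η, (η l : ℝ) ∂ν = N := by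
    rw [← integral_finsetSum _ fun l _ => int _]
    simp [sum_cast]
  rw [Finset.sum_congr rfl fun l _ => hc l k] at hs
  simp only [Finset.sum_const, Finset.card_univ, ZMod.card, nsmul_eq_mul] at hs
  rw [eq_div_iff (NeZero.ne (K : ℝ)), mul_comm, hs]

/-- The stationary pair correlations are determined by the solution of the recurrence with
parameter `β_N` that is symmetric about `K / 2`. -/
theorem IsStationary.integral_pairCount {θ p : ℝ} (hK : 2 ≤ K) (hN : 2 ≤ N) (hθ : 0 < θ)
    (hp : 0 < p) {ν : Measure (Config K N)} [IsProbabilityMeasure ν] (hν : IsStationary θ p ν)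
    (G : ℤ → ℝ) (hG : ∀ n, G (n - 1) + G (n + 1) = betaN N θ p * G n)
    (hs : ∀ n, G (K - n) = G n)
    (h0 : betaN N θ p * G 0 - 2 * G 1 = (betaN N θ p - 2) * (N * (N - 1) / K))
    (k l : ZMod K) : ∫ η, pairCount k l η ∂ν = G (l - k).val := by
  have int : ∀ f : Config K N → ℝ, Integrable f ν := fun f => Integrable.of_finite
  have hN1 : (0 : ℝ) < N - 1 := by
    have : (2 : ℝ) ≤ N := by exact_mod_cast hN
    linarith
  have hβ : (1 + θ) * betaN N θ p = 2 * (1 + θ) + 2 * (p / ((N : ℝ) - 1)) := by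
    have : 1 + θ ≠ 0 := by positivity
    rw [betaN]
    field_simp
  have key : ∀ k l : ZMod K, ∫ η, pairCount (k - 1) l η ∂ν + θ * ∫ η, pairCount (k + 1) l η ∂ν
      + ∫ η, pairCount k (l - 1) η ∂ν + θ * ∫ η, pairCount k (l + 1) η ∂ν
      - (2 * (1 + θ) + 2 * (p / ((N : ℝ) - 1))) * ∫ η, pairCount k l η ∂ν
      + (if k = l then 2 * p * ((N : ℝ) / K) else 0) = 0 := by
    intro k l
    have h := hν.integral_generator (pairCount k l)
    simp only [generator_pairCount hN] at h
    rw [integral_add (int _) (int _), integral_sub (int _) (int _), integral_add (int _) (int _),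
      integral_add (int _) (int _), integral_add (int _) (int _), integral_const_mul,
      integral_const_mul, integral_const_mul] at h
    refine Eq.trans ?_ h
    congr 1
    split_ifs
    · rw [integral_const_mul, hν.integral_count hθ]
    · simp
  -- Uniqueness is applied to the difference of the two candidates, in which the sources cancel.
  refine sub_eq_zero.1 (ZMod.eq_zero_of_killed_harmonic (c := 2 * (p / ((N : ℝ) - 1))) hθ
    (by positivity) (fun k l => ∫ η, pairCount k l η ∂ν - G (l - k).val) (fun k l => ?_) k l)
  have hr := ZMod.recurrence_val hK G _ hG hs (l - k)
  -- Each unit change of `l - k` gets weight `1` from one walker and `θ` from the other.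
  have e1 : l - (k - 1) = l - k + 1 := by ring
  have e2 : l - (k + 1) = l - k - 1 := by ring
  have e3 : l - 1 - k = l - k - 1 := by ring
  have e4 : l + 1 - k = l - k + 1 := by ring
  simp only [e1, e2, e3, e4]
  have e5 : (l - k = 0) ↔ (k = l) := by rw [sub_eq_zero, eq_comm]
  have hsrc : (1 + θ) * (if k = l then betaN N θ p * G 0 - 2 * G 1 else 0)
      = if k = l then 2 * p * ((N : ℝ) / K) else 0 := by
    split_ifs
    · rw [h0]
      have : p / ((N : ℝ) - 1) * (N * (N - 1) / K) = p * (N / K) := by field_simp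
      linear_combination (N * (N - 1) / K : ℝ) * hβ + 2 * this
    · simp
  simp only [e5] at hr
  linear_combination key k l + (1 + θ) * hr + hsrc - G (l - k).val * hβ

theorem IsStationary.covariance_proportion {θ p : ℝ} (hN : 2 ≤ N) (hθ : 0 < θ)
    {ν : Measure (Config K N)} [IsProbabilityMeasure ν] (hν : IsStationary θ p ν) (k l : ZMod K) :
    cov[proportion k, proportion l; ν]
      = (∫ η, pairCount k l η ∂ν) / (N : ℝ) ^ 2 + (if k = l then 1 / ((K : ℝ) * N) else 0)
        - 1 / (K : ℝ) ^ 2 := by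
  have int : ∀ f : Config K N → ℝ, Integrable f ν := fun f => Integrable.of_finite
  have hN0 : (N : ℝ) ≠ 0 := by
    have : N ≠ 0 := by omega
    exact_mod_cast this
  have hK0 : (K : ℝ) ≠ 0 := NeZero.ne _
  have hm : ∀ k : ZMod K, ∫ η, proportion k η ∂ν = 1 / K := fun k => by
    simp only [proportion]
    rw [integral_div, hν.integral_count hθ]
    field_simp
  have hpr : ∀ η : Config K N, (proportion k * proportion l : Config K N → ℝ) η
      = pairCount k l η / (N : ℝ) ^ 2 + (if k = l then (η k : ℝ) / (N : ℝ) ^ 2 else 0) := by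
    intro η
    simp only [Pi.mul_apply, proportion, pairCount]
    split_ifs <;> ring
  rw [covariance_eq_sub MemLp.of_discrete MemLp.of_discrete, hm, hm]
  simp only [hpr]
  rw [integral_add (int _) (int _), integral_div]
  split_ifs
  · rw [integral_div, hν.integral_count hθ]
    field_simp
  · simp
    ring

end Config

/-! ### Chebyshev identities and positivity -/

theorem chebT_sub_one_add_chebT_add_one (n : ℤ) (x : ℝ) :
    chebT (n - 1) x + chebT (n + 1) x = 2 * x * chebT n x := by
  have := congrArg (Polynomial.eval x) (Polynomial.Chebyshev.T_add_one ℝ n)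
  simp only [eval_sub, eval_mul, eval_X, eval_ofNat] at this
  simp only [chebT]
  linarith

theorem chebU_sub_one_add_chebU_add_one (n : ℤ) (x : ℝ) :
    chebU (n - 1) x + chebU (n + 1) x = 2 * x * chebU n x := by
  have := congrArg (Polynomial.eval x) (Polynomial.Chebyshev.U_add_one ℝ n)
  simp only [eval_sub, eval_mul, eval_X, eval_ofNat] at this
  simp only [chebU]
  linarith

theorem chebT_neg (n : ℤ) (x : ℝ) : chebT (-n) x = chebT n x := by
  simp [chebT, Polynomial.Chebyshev.T_neg]

theorem chebU_neg (n : ℤ) (x : ℝ) : chebU (-n) x = -chebU (n - 2) x := by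
  simp [chebU, Polynomial.Chebyshev.U_neg]

theorem chebT_eq_chebU_sub (n : ℤ) (x : ℝ) :
    chebT n x = chebU n x - x * chebU (n - 1) x := by
  simp [chebT, chebU, Polynomial.Chebyshev.T_eq_U_sub_X_mul_U]

/-- Monotonicity closes the induction, as `2 x U_n - U_{n-1} > U_n` when `x ≥ 1`. Positivity keeps
the denominators nonzero. -/
theorem chebU_pos_and_lt {x : ℝ} (hx : 1 ≤ x) (n : ℕ) :
    0 < chebU n x ∧ chebU ((n : ℤ) - 1) x < chebU n x := by
  induction n with
  | zero => simp [chebU]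
  | succ n ih =>
    have h := chebU_sub_one_add_chebU_add_one n x
    have : chebU n x ≤ x * chebU n x := le_mul_of_one_le_left ih.1.le hx
    push_cast
    rw [add_sub_cancel_right]
    constructor <;> linarith [ih.1, ih.2]

theorem chebU_pos {x : ℝ} (hx : 1 ≤ x) (n : ℕ) : 0 < chebU n x := (chebU_pos_and_lt hx n).1

theorem two_lt_betaN {N : ℕ} (hN : 2 ≤ N) {θ p : ℝ} (hθ : 0 < θ) (hp : 0 < p) :
    2 < betaN N θ p := by
  have hN1 : (0 : ℝ) < N - 1 := by
    have : (2 : ℝ) ≤ N := by exact_mod_cast hN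
    linarith
  have : 0 < p / (((N : ℝ) - 1) * (1 + θ)) := by positivity
  rw [betaN]
  linarith

/-! ### Explicit pair correlations by parity -/

namespace Config

variable {K N : ℕ} [NeZero K]

/-- The pair correlations on a cycle of even length. -/
theorem IsStationary.integral_pairCount_even {θ p : ℝ} (hN : 2 ≤ N) (hθ : 0 < θ) (hp : 0 < p)
    {ν : Measure (Config K N)} [IsProbabilityMeasure ν] (hν : IsStationary θ p ν)
    {K₂ : ℕ} (hK₂ : 1 ≤ K₂) (hK : K = 2 * K₂) (k l : ZMod K) :
    ∫ η, pairCount k l η ∂ν = (N * ((N : ℝ) - 1) / K) * (2 / (betaN N θ p + 2))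
      * (chebT (K₂ - (l - k).val) (betaN N θ p / 2) / chebU ((K₂ : ℤ) - 1) (betaN N θ p / 2)) := by
  have hβ := two_lt_betaN hN hθ hp
  set β := betaN N θ p with hβdef
  have hU : chebU ((K₂ : ℤ) - 1) (β / 2) ≠ 0 := by
    have := chebU_pos (x := β / 2) (by linarith) (K₂ - 1)
    rw [Nat.cast_sub hK₂, Nat.cast_one] at this
    exact this.ne'
  refine hν.integral_pairCount (by omega) hN hθ hp
    (fun n => (N * ((N : ℝ) - 1) / K) * (2 / (β + 2))
      * (chebT (K₂ - n) (β / 2) / chebU ((K₂ : ℤ) - 1) (β / 2)))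
    (fun n => ?_) (fun n => ?_) ?_ k l
  · have h := chebT_sub_one_add_chebT_add_one (K₂ - n) (β / 2)
    rw [← hβdef, show (K₂ : ℤ) - (n - 1) = K₂ - n + 1 by ring,
      show (K₂ : ℤ) - (n + 1) = K₂ - n - 1 by ring]
    linear_combination (N * ((N : ℝ) - 1) / K) * (2 / (β + 2))
      / chebU ((K₂ : ℤ) - 1) (β / 2) * h
  · rw [show (K₂ : ℤ) - (K - n) = -(K₂ - n) by rw [hK]; push_cast; ring, chebT_neg]
  · rw [← hβdef, sub_zero]
    have h1 := chebT_eq_chebU_sub K₂ (β / 2)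
    have h2 := chebT_eq_chebU_sub ((K₂ : ℤ) - 1) (β / 2)
    have h3 := chebU_sub_one_add_chebU_add_one ((K₂ : ℤ) - 1) (β / 2)
    rw [sub_add_cancel] at h3
    -- With `x = β / 2` this is `x T_n - T_{n-1} = (x ^ 2 - 1) U_{n-1}`, doubled. The factor `β - 2`
    -- matches the source; the prefactor `2 / (β + 2)` absorbs the rest.
    have h : β * chebT K₂ (β / 2) - 2 * chebT ((K₂ : ℤ) - 1) (β / 2)
        = (β - 2) * (β + 2) / 2 * chebU ((K₂ : ℤ) - 1) (β / 2) := by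
      linear_combination β * h1 - 2 * h2 + β * h3
    have hβ2 : β + 2 ≠ 0 := by linarith
    calc _ = (N * ((N : ℝ) - 1) / K) * (2 / (β + 2)) *
          ((β * chebT K₂ (β / 2) - 2 * chebT ((K₂ : ℤ) - 1) (β / 2))
            / chebU ((K₂ : ℤ) - 1) (β / 2)) := by ring
      _ = _ := by
        rw [h]
        field_simp

/-- The pair correlations on a cycle of odd length. -/
theorem IsStationary.integral_pairCount_odd {θ p : ℝ} (hN : 2 ≤ N) (hθ : 0 < θ) (hp : 0 < p)
    {ν : Measure (Config K N)} [IsProbabilityMeasure ν] (hν : IsStationary θ p ν)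
    {K₂ : ℕ} (hK₂ : 1 ≤ K₂) (hK : K = 2 * K₂ + 1) (k l : ZMod K) :
    ∫ η, pairCount k l η ∂ν = (N * ((N : ℝ) - 1) / K)
      * ((chebU (K₂ - (l - k).val) (betaN N θ p / 2)
          - chebU (K₂ - (l - k).val - 1) (betaN N θ p / 2))
        / (chebU K₂ (betaN N θ p / 2) + chebU ((K₂ : ℤ) - 1) (betaN N θ p / 2))) := by
  have hβ := two_lt_betaN hN hθ hp
  set β := betaN N θ p with hβdef
  have hU : chebU K₂ (β / 2) + chebU ((K₂ : ℤ) - 1) (β / 2) ≠ 0 := by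
    have h1 := chebU_pos (x := β / 2) (by linarith) (K₂ - 1)
    have h2 := chebU_pos (x := β / 2) (by linarith) K₂
    rw [Nat.cast_sub hK₂, Nat.cast_one] at h1
    exact (add_pos h2 h1).ne'
  -- `V_m = U_m - U_{m-1}` satisfies `V_{-m-1} = V_m`; this half-integer symmetry suits odd `K`.
  refine hν.integral_pairCount (by omega) hN hθ hp
    (fun n => (N * ((N : ℝ) - 1) / K)
      * ((chebU (K₂ - n) (β / 2) - chebU (K₂ - n - 1) (β / 2))
        / (chebU K₂ (β / 2) + chebU ((K₂ : ℤ) - 1) (β / 2))))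
    (fun n => ?_) (fun n => ?_) ?_ k l
  · have h := chebU_sub_one_add_chebU_add_one (K₂ - n) (β / 2)
    have h' := chebU_sub_one_add_chebU_add_one (K₂ - n - 1) (β / 2)
    rw [← hβdef, show (K₂ : ℤ) - (n - 1) - 1 = K₂ - n - 1 + 1 by ring,
      show (K₂ : ℤ) - (n - 1) = K₂ - n + 1 by ring,
      show (K₂ : ℤ) - (n + 1) - 1 = K₂ - n - 1 - 1 by ring,
      show (K₂ : ℤ) - (n + 1) = K₂ - n - 1 by ring]
    linear_combination (N * ((N : ℝ) - 1) / K)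
      / (chebU K₂ (β / 2) + chebU ((K₂ : ℤ) - 1) (β / 2)) * (h - h')
  · rw [show (K₂ : ℤ) - (K - n) - 1 = -(K₂ - n + 2) by rw [hK]; push_cast; ring,
      show (K₂ : ℤ) - (K - n) = -(K₂ - n + 1) by rw [hK]; push_cast; ring, chebU_neg, chebU_neg,
      show (K₂ : ℤ) - n + 2 - 2 = K₂ - n by ring, show (K₂ : ℤ) - n + 1 - 2 = K₂ - n - 1 by ring]
    ring
  · rw [← hβdef, sub_zero]
    have h1 := chebU_sub_one_add_chebU_add_one ((K₂ : ℤ) - 1) (β / 2)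
    rw [sub_add_cancel] at h1
    have h : β * (chebU K₂ (β / 2) - chebU ((K₂ : ℤ) - 1) (β / 2))
        - 2 * (chebU ((K₂ : ℤ) - 1) (β / 2) - chebU ((K₂ : ℤ) - 1 - 1) (β / 2))
        = (β - 2) * (chebU K₂ (β / 2) + chebU ((K₂ : ℤ) - 1) (β / 2)) := by
      linear_combination 2 * h1
    calc _ = (N * ((N : ℝ) - 1) / K) *
          ((β * (chebU K₂ (β / 2) - chebU ((K₂ : ℤ) - 1) (β / 2))
              - 2 * (chebU ((K₂ : ℤ) - 1) (β / 2) - chebU ((K₂ : ℤ) - 1 - 1) (β / 2)))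
            / (chebU K₂ (β / 2) + chebU ((K₂ : ℤ) - 1) (β / 2))) := by ring
      _ = _ := by
        rw [h]
        field_simp

end Config

theorem theorem3 (K N : ℕ) [NeZero K] (hN : 2 ≤ N) (θ p : ℝ) (hθ : 0 < θ) (hp : 0 < p)
    (ν : Measure (Config K N)) [IsProbabilityMeasure ν] (hν : Config.IsStationary θ p ν) :
    (∀ K₂ : ℕ, 2 ≤ K₂ → K = 2 * K₂ →
      Var[Config.proportion (0 : ZMod K); ν]
          = ((N : ℝ) - 1) / (K * N) * (2 / (betaN N θ p + 2))
              * (chebT K₂ (betaN N θ p / 2) / chebU ((K₂ : ℤ) - 1) (betaN N θ p / 2))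
            + 1 / (K * N) - 1 / (K : ℝ) ^ 2 ∧
      ∀ k : ℕ, 1 ≤ k → k ≤ K₂ - 1 →
        cov[Config.proportion (0 : ZMod K), Config.proportion (k : ZMod K); ν]
          = ((N : ℝ) - 1) / (K * N) * (2 / (betaN N θ p + 2))
              * (chebT ((K₂ : ℤ) - k) (betaN N θ p / 2)
                  / chebU ((K₂ : ℤ) - 1) (betaN N θ p / 2))
            - 1 / (K : ℝ) ^ 2) ∧
    (∀ K₂ : ℕ, 1 ≤ K₂ → K = 2 * K₂ + 1 →
      Var[Config.proportion (0 : ZMod K); ν]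
          = ((N : ℝ) - 1) / (K * N)
              * ((chebU K₂ (betaN N θ p / 2) - chebU ((K₂ : ℤ) - 1) (betaN N θ p / 2))
                  / (chebU K₂ (betaN N θ p / 2) + chebU ((K₂ : ℤ) - 1) (betaN N θ p / 2)))
            + 1 / (K * N) - 1 / (K : ℝ) ^ 2 ∧
      ∀ k : ℕ, 1 ≤ k → k ≤ K₂ →
        cov[Config.proportion (0 : ZMod K), Config.proportion (k : ZMod K); ν]
          = ((N : ℝ) - 1) / (K * N)
              * ((chebU ((K₂ : ℤ) - k) (betaN N θ p / 2)
                    - chebU ((K₂ : ℤ) - k - 1) (betaN N θ p / 2))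
                  / (chebU K₂ (betaN N θ p / 2) + chebU ((K₂ : ℤ) - 1) (betaN N θ p / 2)))
            - 1 / (K : ℝ) ^ 2) := by
  have hN0 : (N : ℝ) ≠ 0 := by
    have : N ≠ 0 := by omega
    exact_mod_cast this
  have hK0 : (K : ℝ) ≠ 0 := NeZero.ne _
  have hc : ∀ x y : ℝ, N * ((N : ℝ) - 1) / K * x * y / (N : ℝ) ^ 2
      = ((N : ℝ) - 1) / (K * N) * x * y := fun x y => by field_simp
  have hc' : ∀ x : ℝ, N * ((N : ℝ) - 1) / K * x / (N : ℝ) ^ 2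
      = ((N : ℝ) - 1) / (K * N) * x := fun x => by field_simp
  have hval : ∀ k : ℕ, k < K → ((k : ZMod K) - 0).val = k := fun k hk => by
    rw [sub_zero, ZMod.val_natCast_of_lt hk]
  have hne : ∀ k : ℕ, 1 ≤ k → k < K → (0 : ZMod K) ≠ k := fun k h1 hk h => by
    have := hval k hk
    rw [← h, sub_zero, ZMod.val_zero] at this
    omega
  refine ⟨fun K₂ hK₂ hK => ⟨?_, fun k hk1 hk2 => ?_⟩, fun K₂ hK₂ hK => ⟨?_, fun k hk1 hk2 => ?_⟩⟩
  · rw [← covariance_self AEMeasurable.of_discrete, hν.covariance_proportion hN hθ, if_pos rfl,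
      hν.integral_pairCount_even hN hθ hp (by omega) hK, sub_zero, ZMod.val_zero, Nat.cast_zero,
      sub_zero, hc]
  · rw [hν.covariance_proportion hN hθ, if_neg (hne k hk1 (by omega)), add_zero,
      hν.integral_pairCount_even hN hθ hp (by omega) hK, hval k (by omega), hc]
  · rw [← covariance_self AEMeasurable.of_discrete, hν.covariance_proportion hN hθ, if_pos rfl,
      hν.integral_pairCount_odd hN hθ hp hK₂ hK, sub_zero, ZMod.val_zero, Nat.cast_zero,
      sub_zero, hc']
  · rw [hν.covariance_proportion hN hθ, if_neg (hne k hk1 (by omega)), add_zero,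
      hν.integral_pairCount_odd hN hθ hp hK₂ hK, hval k (by omega), hc']
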